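/- **Theorem (Comparison principle).** Let $n\ge 1$, $0<\lambda\le\Lambda<\infty$, and let $\varphi:(0,\infty)\to(0,\infty)$ be measurable and satisfy, for some constants $a\ge 1$ and $0<\underline\sigma\le\overline\sigma<2$, $$a^{-1}\Big(\frac Rr\Big)^{\underline\sigma}\le\frac{\varphi(R)}{\varphi(r)}\le a\Big(\frac Rr\Big)^{\overline\sigma}\qquad\text{for all }0<r\le R<\infty .$$ Put $C_\varphi=\Big(\int_{\mathbb R^n}\frac{1-\cos y_1}{|y|^n\varphi(|y|)}\,dy\Big)^{-1}$ and let $\mathcal L_0$ be the class of operators $Lu(x)=\int_{\mathbb R^n}\big(u(x+y)+u(x-y)-2u(x)\big)K(y)\,dy$ whose kernels $K$ are measurable, satisfy $K(-y)=K(y)$, $\int_{\mathbb R^n}\frac{|y|^2}{1+|y|^2}K(y)\,dy<\infty$, and $$C_\varphi\frac{\lambda}{|y|^n\varphi(|y|)}\le K(y)\le C_\varphi\frac{\Lambda}{|y|^n\varphi(|y|)}\qquad (y\neq 0).$$ Put $\mathcal M^+u(x)=\sup_{L\in\mathcal L_0}Lu(x)$ and $\mathcal M^-u(x)=\inf_{L\in\mathcal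 L_0}Lu(x)$. A function $\psi$ is $C^{1,1}$ at $x$ if there are $p\in\mathbb R^n$ and $M>0$ with $|\psi(x+y)-\psi(x)-p\cdot y|\le M|y|^2$ for all small $|y|$. Functions on $\mathbb R^n$ are understood to be Lebesgue measurable. Let $I$ be a translation invariant operator that is elliptic with respect to $\mathcal L_0$, that is: (i) $Iu(x)\in\mathbb R$ is defined whenever $u$ is bounded on $\mathbb R^n$ and $C^{1,1}$ at $x$, and then $I(u(\cdot+z))(x-z)=Iu(x)$ for all $z\in\mathbb R^n$; (ii) if $u$ is bounded on $\mathbb R^n$ and $C^2$ in an open set $U$, then $Iu$ is continuous in $U$; (iii) if $u,v$ are bounded on $\mathbb R^n$ and $C^{1,1}$ at $x$, then $$\mathcal M^-(u-v)(x)\le Iu(x)-Iv(x)\le\mathcal M^+(u-v)(x).$$ Let $\Omega\subset\mathbb R^n$ be bounded and open and let $f$ be continuous in $\Omega$. For a bounded function $u:\mathbb R^n\to\mathbb R$, the inequality $Iu\ge f$ (respectively $Iu\le f$) in $\Omega$ in the viscosity sense means that $u$ is upper (respectively lower) semicontinuous in $\overline\Omega$ and that, whenever $x\in\Omega$, $N$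 is an open neighbourhood of $x$ and $\psi$ is a $C^2$ function in $N$ with $\psi(x)=u(x)$ and $\psi>u$ (respectively $\psi<u$) in $N\setminus\{x\}$, the function $w$ equal to $\psi$ in $N$ and to $u$ in $\mathbb R^n\setminus N$ satisfies, provided that it is bounded, $Iw(x)\ge f(x)$ (respectively $Iw(x)\le f(x)$). If $u,v:\mathbb R^n\to\mathbb R$ are bounded functions such that $Iu\ge f$ and $Iv\le f$ in $\Omega$ in the viscosity sense and $u\le v$ in $\mathbb R^n\setminus\Omega$, then $u\le v$ in $\Omega$. -/

import Mathlib

noncomputable section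

namespace IntegroDiff

open MeasureTheory

/-- The space `ℝⁿ` with its Euclidean norm and Lebesgue measure. -/
abbrev Rn (n : ℕ) : Type := EuclideanSpace ℝ (Fin n)

variable {n : ℕ}

/-- `u` is a bounded (Lebesgue measurable) function on `ℝⁿ`. -/
def IsBoundedFun (u : Rn n → ℝ) : Prop :=
  AEMeasurable u volume ∧ ∃ C : ℝ, ∀ x, |u x| ≤ C

/-- The second-order difference `δ(u,x,y) = u(x+y) + u(x-y) - 2u(x)`. -/
def secondDiff (u : Rn n → ℝ) (x y : Rn n) : ℝ :=
  u (x + y) + u (x - y) - 2 * u x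

/-- The linear integro-differential operator `L u(x) = ∫ δ(u,x,y) K(y) dy` with kernel `K`. -/
def linOp (K : Rn n → ℝ) (u : Rn n → ℝ) (x : Rn n) : ℝ :=
  ∫ y, secondDiff u x y * K y

/-- Weak scaling condition with constants `a`, `σ₁`, `σ₂` for a measurable
`φ : (0,∞) → (0,∞)`; the values of `φ` outside `(0,∞)` are irrelevant. -/
structure WeakScaling (φ : ℝ → ℝ) (a σ₁ σ₂ : ℝ) : Prop where
  meas : AEMeasurable φ (volume.restrict (Set.Ioi (0 : ℝ)))
  pos : ∀ r, 0 < r → 0 < φ r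
  one_le_a : 1 ≤ a
  σ₁_pos : 0 < σ₁
  σ₁_le_σ₂ : σ₁ ≤ σ₂
  σ₂_lt_two : σ₂ < 2
  scaling : ∀ r R : ℝ, 0 < r → r ≤ R →
    a⁻¹ * (R / r) ^ σ₁ ≤ φ R / φ r ∧ φ R / φ r ≤ a * (R / r) ^ σ₂

/-- The normalizing constant `C_φ = (∫ (1 - cos y₁) / (|y|ⁿ φ(|y|)) dy)⁻¹`. -/
def normConst (n : ℕ) [NeZero n] (φ : ℝ → ℝ) : ℝ :=
  (∫ y : Rn n, (1 - Real.cos (y 0)) / (‖y‖ ^ n * φ ‖y‖))⁻¹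

/-- The class `𝓛₀`, given through the kernels of its operators: symmetric (measurable) kernels
`K` with `∫ |y|² / (1 + |y|²) K(y) dy < ∞` and
`C_φ λ / (|y|ⁿ φ(|y|)) ≤ K(y) ≤ C_φ Λ / (|y|ⁿ φ(|y|))`. -/
def classL0 (n : ℕ) [NeZero n] (φ : ℝ → ℝ) (lam Lam : ℝ) : Set (Rn n → ℝ) :=
  {K | AEMeasurable K volume ∧ (∀ y, K (-y) = K y) ∧
    Integrable (fun y : Rn n => ‖y‖ ^ 2 / (1 + ‖y‖ ^ 2) * K y) volume ∧
    ∀ y, y ≠ 0 →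
      normConst n φ * (lam / (‖y‖ ^ n * φ ‖y‖)) ≤ K y ∧
      K y ≤ normConst n φ * (Lam / (‖y‖ ^ n * φ ‖y‖))}

/-- The maximal operator `𝓜⁺ u(x) = sup_L L u(x)` of a class of kernels. -/
def maxOp (𝓛 : Set (Rn n → ℝ)) (u : Rn n → ℝ) (x : Rn n) : EReal :=
  ⨆ K ∈ 𝓛, ((linOp K u x : ℝ) : EReal)

/-- The minimal operator `𝓜⁻ u(x) = inf_L L u(x)` of a class of kernels. -/
def minOp (𝓛 : Set (Rn n → ℝ)) (u : Rn n → ℝ) (x : Rn n) : EReal :=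
  ⨅ K ∈ 𝓛, ((linOp K u x : ℝ) : EReal)

/-- `ψ` is `C^{1,1}` at the point `x`. -/
def C11At (ψ : Rn n → ℝ) (x : Rn n) : Prop :=
  ∃ (p : Rn n) (M : ℝ), 0 < M ∧
    ∀ᶠ y in nhds (0 : Rn n), |ψ (x + y) - ψ x - inner ℝ p y| ≤ M * ‖y‖ ^ 2

/-- `I` is elliptic with respect to the class `𝓛`. The value `I u x` is meaningful when `u` is
bounded and `C^{1,1}` at `x`; for other pairs `(u, x)` it is arbitrary and nothing is required. -/
structure IsElliptic (𝓛 : Set (Rn n → ℝ)) (I : (Rn n → ℝ) → Rn n → ℝ) : Prop where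
  continuousOn : ∀ (u : Rn n → ℝ) (U : Set (Rn n)), IsBoundedFun u → IsOpen U →
    ContDiffOn ℝ 2 u U → ContinuousOn (I u) U
  lower : ∀ (u v : Rn n → ℝ) (x : Rn n), IsBoundedFun u → IsBoundedFun v →
    C11At u x → C11At v x → minOp 𝓛 (u - v) x ≤ ((I u x - I v x : ℝ) : EReal)
  upper : ∀ (u v : Rn n → ℝ) (x : Rn n), IsBoundedFun u → IsBoundedFun v →
    C11At u x → C11At v x → ((I u x - I v x : ℝ) : EReal) ≤ maxOp 𝓛 (u - v) x

/-- `I` commutes with translations, wherever its values are meaningful. -/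
def IsTranslationInvariant (I : (Rn n → ℝ) → Rn n → ℝ) : Prop :=
  ∀ (u : Rn n → ℝ) (z x : Rn n), IsBoundedFun u → C11At u (x + z) →
    I (fun y => u (y + z)) x = I u (x + z)

open Classical in
/-- The function equal to `ψ` in `N` and to `u` outside `N`. -/
def glue (N : Set (Rn n)) (ψ u : Rn n → ℝ) : Rn n → ℝ :=
  fun y => if y ∈ N then ψ y else u y

/-- `I u ≥ f` in `Ω` in the viscosity sense. -/
structure IsViscositySub (I : (Rn n → ℝ) → Rn n → ℝ) (Ω : Set (Rn n)) (f u : Rn n → ℝ) :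
    Prop where
  bounded : IsBoundedFun u
  usc : UpperSemicontinuousOn u (closure Ω)
  test : ∀ x ∈ Ω, ∀ (N : Set (Rn n)) (ψ : Rn n → ℝ), IsOpen N → x ∈ N →
    ContDiffOn ℝ 2 ψ N → ψ x = u x → (∀ y ∈ N, y ≠ x → u y < ψ y) →
    IsBoundedFun (glue N ψ u) → f x ≤ I (glue N ψ u) x

/-- `I u ≤ f` in `Ω` in the viscosity sense. -/
structure IsViscositySuper (I : (Rn n → ℝ) → Rn n → ℝ) (Ω : Set (Rn n)) (f u : Rn n → ℝ) :
    Prop where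
  bounded : IsBoundedFun u
  lsc : LowerSemicontinuousOn u (closure Ω)
  test : ∀ x ∈ Ω, ∀ (N : Set (Rn n)) (ψ : Rn n → ℝ), IsOpen N → x ∈ N →
    ContDiffOn ℝ 2 ψ N → ψ x = u x → (∀ y ∈ N, y ≠ x → ψ y < u y) →
    IsBoundedFun (glue N ψ u) → I (glue N ψ u) x ≤ f x

end IntegroDiff

end

/-! Suppose `u - v` is positive at `p ∈ Ω` and put `m = u p - v p`. Doubling the variables gives
maximizers `(x, y)` of `u(x) - v(y) - c|x - y|²` over the closure of `Ω`, converging to one point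
`q` with `u q - v q ≥ m`; hence `q ∈ Ω`. Freezing one variable in the maximality inequality yields
paraboloids that touch `u` at `x` and `v` at `y`. Translation invariance moves both points to the
origin, and ellipticity bounds `f x - f y` by `𝓜⁺F(0)`, where `F(z)` is `u(x+z) - v(y+z)` outside a
ball of radius `r` and a difference of paraboloids inside it (`sub_le_of_doubling_max`).

`linOp_le_of_secondDiff_le` bounds `𝓜⁺F(0)` by three terms. The quadratic core carries the factor
`c` but vanishes as `r → 0` with the pair fixed. The error of replacing `x`, `y` by `q` at distances
`≥ ρ` vanishes as `x, y → q`, because translations are continuous in weighted `L¹`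
(`tendsto_integral_abs_translate_sub_mul`); `u` and `v` need no regularity outside the closure of
`Ω`. The last term is strictly negative: for `|z| ≥ D` the point `q + z` lies outside `Ω`, where `u
≤ v`, and the kernels are bounded below there. Since `f x - f y → 0`, the limit is a contradiction.
-/

noncomputable section

namespace IntegroDiff

open MeasureTheory Filter Topology Set

variable {n : ℕ}

/-! ### Continuity of translations in weighted `L¹`. -/

/-- Translations act continuously on `L¹`. -/
theorem tendsto_integral_abs_translate_sub {g : Rn n → ℝ} (hg : Integrable g volume)
    {t : ℕ → Rn n} {s : Rn n} (ht : Tendsto t atTop (𝓝 s)) :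
    Tendsto (fun k => ∫ z, |g (t k + z) - g (s + z)|) atTop (𝓝 0) := by
  have hmp : ∀ c : Rn n, MeasurePreserving (fun z : Rn n => c + z) volume volume :=
    fun c => measurePreserving_add_left volume c
  have hgL : MemLp g 1 (volume : Measure (Rn n)) := memLp_one_iff_integrable.2 hg
  -- Currying addition makes `c ↦ (z ↦ c + z)` continuous for the compact-open topology, the form in
  -- which composition acts continuously on `Lp`.
  let T : Rn n → C(Rn n, Rn n) :=
    (ContinuousMap.mk (fun a : Rn n × Rn n => a.1 + a.2) continuous_add).curry
  have hT : Continuous T := ContinuousMap.continuous _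
  have h1 := (tendsto_const_nhds (x := hgL.toLp g) (f := atTop (α := ℕ))).compMeasurePreservingLp
    (g := fun k => T (t k)) (g₀ := T s) ((hT.tendsto s).comp ht) (fun k => hmp (t k)) (hmp s)
    (by simp)
  have h2 := (Lp.tendsto_Lp_iff_tendsto_eLpNorm'' (fun k z => g (t k + z))
    (fun k => hgL.comp_measurePreserving (hmp (t k))) (fun z => g (s + z))
    (hgL.comp_measurePreserving (hmp s))).1 h1
  have h3 := (ENNReal.tendsto_toReal (by simp : (0 : ENNReal) ≠ ⊤)).comp h2
  refine h3.congr fun k => ?_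
  have hi : Integrable (fun z => g (t k + z) - g (s + z)) volume :=
    (hg.comp_add_left (t k)).sub (hg.comp_add_left s)
  have := integral_norm_eq_lintegral_enorm hi.aestronglyMeasurable
  simp only [Real.norm_eq_abs] at this
  rw [this]
  simp [eLpNorm_one_eq_lintegral_enorm]

theorem aemeasurable_translate {g : Rn n → ℝ} (hg : AEMeasurable g volume) (c : Rn n) :
    AEMeasurable (fun z => g (c + z)) volume :=
  hg.comp_quasiMeasurePreserving (measurePreserving_add_left volume c).quasiMeasurePreserving

theorem aemeasurable_reflect {g : Rn n → ℝ} (hg : AEMeasurable g volume) :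
    AEMeasurable (fun z => g (-z)) volume :=
  hg.comp_quasiMeasurePreserving (Measure.measurePreserving_neg volume).quasiMeasurePreserving

theorem integrable_bounded_mul {g h : Rn n → ℝ} {C : ℝ} (hg : AEMeasurable g volume)
    (hC : ∀ z, |g z| ≤ C) (hh : Integrable h volume) :
    Integrable (fun z => g z * h z) volume :=
  hh.bdd_mul hg.aestronglyMeasurable (Eventually.of_forall hC)

theorem integrable_abs_translate_sub_mul {g h : Rn n → ℝ} (hg : IsBoundedFun g)
    (hh : Integrable h volume) (c s : Rn n) :
    Integrable (fun z => |g (c + z) - g (s + z)| * h z) volume := by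
  obtain ⟨hm, C, hC⟩ := hg
  refine integrable_bounded_mul (C := 2 * C)
    ((aemeasurable_translate hm c).sub (aemeasurable_translate hm s)).abs (fun z => ?_) hh
  rw [abs_abs]
  have h1 := hC (c + z)
  have h2 := hC (s + z)
  have h3 := abs_sub (g (c + z)) (g (s + z))
  linarith

/-- For bounded `g` and an integrable weight `h`, the `h`-weighted `L¹` distance between
translates of `g` tends to zero. -/
theorem tendsto_integral_abs_translate_sub_mul {g h : Rn n → ℝ} (hg : IsBoundedFun g)
    (hh : Integrable h volume) (hh0 : ∀ z, 0 ≤ h z)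
    {t : ℕ → Rn n} {s : Rn n} (ht : Tendsto t atTop (𝓝 s)) :
    Tendsto (fun k => ∫ z, |g (t k + z) - g (s + z)| * h z) atTop (𝓝 0) := by
  have hint := fun c => integrable_abs_translate_sub_mul hg hh c s
  obtain ⟨hm, C, hC⟩ := hg
  have hC0 : 0 ≤ C := (abs_nonneg _).trans (hC 0)
  rw [Metric.tendsto_atTop]
  intro ε hε
  -- A compactly supported `h₀` reduces the claim to `g` cut off to a ball. The remainder costs at
  -- most `2C · ε/(4(C+1)) ≤ ε/2`; the `+ 1` covers `C = 0`.
  obtain ⟨h₀, hsupp, hclose, hcont, hint₀⟩ :=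
    hh.exists_hasCompactSupport_integral_sub_le (ε := ε / (4 * (C + 1))) (by positivity)
  obtain ⟨M, hM⟩ := hcont.bounded_above_of_compact_support hsupp
  have hM0 : 0 ≤ M := (norm_nonneg _).trans (hM 0)
  obtain ⟨R, hR⟩ := hsupp.isCompact.isBounded.subset_closedBall (0 : Rn n)
  let B : Set (Rn n) := Metric.closedBall 0 (R + ‖s‖ + 1)
  have hgB : Integrable (B.indicator g) volume := by
    rw [integrable_indicator_iff measurableSet_closedBall]
    exact Measure.integrableOn_of_bounded (measure_closedBall_lt_top).ne
      hm.aestronglyMeasurable (Eventually.of_forall hC)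
  have hlim := tendsto_integral_abs_translate_sub hgB ht
  obtain ⟨k₁, hk₁⟩ := (Metric.tendsto_atTop.1 hlim) (ε / (2 * (M + 1))) (by positivity)
  obtain ⟨k₂, hk₂⟩ := (Metric.tendsto_atTop.1 ht) 1 one_pos
  refine ⟨max k₁ k₂, fun k hk => ?_⟩
  have hk1 := hk₁ k (le_of_max_le_left hk)
  have hk2 := hk₂ k (le_of_max_le_right hk)
  have hDint : Integrable (fun z => |B.indicator g (t k + z) - B.indicator g (s + z)|) volume :=
    ((hgB.comp_add_left (t k)).sub (hgB.comp_add_left s)).abs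
  have hle : ∀ z, |g (t k + z) - g (s + z)| * h z ≤
      M * |B.indicator g (t k + z) - B.indicator g (s + z)| + 2 * C * ‖h z - h₀ z‖ := by
    intro z
    have hb : |g (t k + z) - g (s + z)| ≤ 2 * C := by
      have h1 := hC (t k + z)
      have h2 := hC (s + z)
      have h3 := abs_sub (g (t k + z)) (g (s + z))
      linarith
    have hz : h z ≤ |h₀ z| + ‖h z - h₀ z‖ := by
      have h1 := le_abs_self (h₀ z)
      have h2 := le_abs_self (h z - h₀ z)
      rw [Real.norm_eq_abs]; linarith
    have hmain : |g (t k + z) - g (s + z)| * |h₀ z| ≤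
        M * |B.indicator g (t k + z) - B.indicator g (s + z)| := by
      by_cases hzs : z ∈ tsupport h₀
      · have hzR : ‖z‖ ≤ R := by simpa using hR hzs
        have htk : ‖t k‖ ≤ ‖s‖ + 1 := by
          rw [dist_eq_norm] at hk2
          have := norm_le_norm_add_norm_sub' (t k) s
          linarith
        have hB1 : t k + z ∈ B := by
          simp only [B, Metric.mem_closedBall, dist_zero_right]
          have := norm_add_le (t k) z
          linarith
        have hB2 : s + z ∈ B := by
          simp only [B, Metric.mem_closedBall, dist_zero_right]
          have := norm_add_le s z
          linarith
        rw [indicator_of_mem hB1, indicator_of_mem hB2, mul_comm]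
        exact mul_le_mul_of_nonneg_right (hM z) (abs_nonneg _)
      · rw [image_eq_zero_of_notMem_tsupport hzs]
        simp only [abs_zero, mul_zero]
        positivity
    calc |g (t k + z) - g (s + z)| * h z
        ≤ |g (t k + z) - g (s + z)| * (|h₀ z| + ‖h z - h₀ z‖) :=
          mul_le_mul_of_nonneg_left hz (abs_nonneg _)
      _ ≤ _ := by
          rw [mul_add]
          exact add_le_add hmain (mul_le_mul_of_nonneg_right hb (norm_nonneg _))
  have hhint : Integrable (fun z => ‖h z - h₀ z‖) volume := (hh.sub hint₀).norm
  have hI := integral_mono (hint (t k)) ((hDint.const_mul M).add (hhint.const_mul (2 * C))) hle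
  simp only [Pi.add_apply] at hI
  rw [integral_add (hDint.const_mul M) (hhint.const_mul (2 * C)),
    integral_const_mul, integral_const_mul] at hI
  have hnn : 0 ≤ ∫ z, |g (t k + z) - g (s + z)| * h z :=
    integral_nonneg fun z => mul_nonneg (abs_nonneg _) (hh0 z)
  rw [Real.dist_eq, sub_zero] at hk1 ⊢
  rw [abs_of_nonneg hnn]
  have hk1' := (le_abs_self _).trans_lt hk1
  have e1 : M * ∫ z, |B.indicator g (t k + z) - B.indicator g (s + z)| < ε / 2 := by
    have : 0 ≤ ∫ z, |B.indicator g (t k + z) - B.indicator g (s + z)| :=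
      integral_nonneg fun z => abs_nonneg _
    rw [lt_div_iff₀ (by positivity)] at hk1'
    nlinarith
  have e2 : 2 * C * ∫ z, ‖h z - h₀ z‖ ≤ ε / 2 := by
    have h0 : 0 ≤ ∫ z, ‖h z - h₀ z‖ := integral_nonneg fun z => norm_nonneg _
    rw [le_div_iff₀ (by positivity)] at hclose
    nlinarith
  exact hI.trans_lt (by simpa using (add_lt_add_of_lt_of_le e1 e2))

/-! ### Integrability of the reference kernel and positivity of `C_φ`. -/

/-- The reference kernel `|y|⁻ⁿ φ(|y|)⁻¹`. -/
def refKernel (φ : ℝ → ℝ) (y : Rn n) : ℝ := 1 / (‖y‖ ^ n * φ ‖y‖)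

/-- The Lévy weight `|y|² / (1 + |y|²)`. -/
def levyWeight (y : Rn n) : ℝ := ‖y‖ ^ 2 / (1 + ‖y‖ ^ 2)

theorem levyWeight_nonneg (y : Rn n) : 0 ≤ levyWeight y := by
  unfold levyWeight; positivity

theorem refKernel_pos {φ : ℝ → ℝ} {a σ₁ σ₂ : ℝ} (hφ : WeakScaling φ a σ₁ σ₂) {y : Rn n}
    (hy : y ≠ 0) : 0 < refKernel φ y := by
  have h := norm_pos_iff.2 hy
  have := hφ.pos _ h
  unfold refKernel; positivity

/-- Scaling against `φ 1` dominates the integrand by a multiple of `r^(1-σ₂)` on `(0,1]`, integrable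
as `σ₂ < 2`, and of `r^(-1-σ₁)` on `(1,∞)`, integrable as `σ₁ > 0`. -/
theorem integrableOn_scaling {φ : ℝ → ℝ} {a σ₁ σ₂ : ℝ} (hφ : WeakScaling φ a σ₁ σ₂) :
    IntegrableOn (fun r : ℝ => r / (1 + r ^ 2) / φ r) (Ioi 0) volume := by
  have hmeas : AEMeasurable (fun r : ℝ => r / (1 + r ^ 2) / φ r) (volume.restrict (Ioi 0)) :=
    (by fun_prop : Measurable fun r : ℝ => r / (1 + r ^ 2)).aemeasurable.div hφ.meas
  have hφ1 := hφ.pos 1 one_pos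
  have ha : 0 < a := one_pos.trans_le hφ.one_le_a
  rw [← Ioc_union_Ioi_eq_Ioi (zero_le_one' ℝ)]
  refine IntegrableOn.union ?_ ?_
  · have hpow : IntegrableOn (fun r : ℝ => a / φ 1 * r ^ (1 - σ₂)) (Ioc 0 1) volume :=
      ((intervalIntegrable_iff_integrableOn_Ioc_of_le zero_le_one).1
        (intervalIntegral.intervalIntegrable_rpow' (by linarith [hφ.σ₂_lt_two]))).const_mul _
    refine hpow.mono' (hmeas.mono_measure (Measure.restrict_mono Ioc_subset_Ioi_self
      le_rfl)).aestronglyMeasurable ?_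
    refine (ae_restrict_iff' measurableSet_Ioc).2 (Eventually.of_forall fun r hr => ?_)
    have hr0 := hr.1
    have hφr := hφ.pos r hr0
    have hs := (hφ.scaling r 1 hr0 hr.2).2
    have hinv : 1 / φ r ≤ a / φ 1 * r ^ (-σ₂) := by
      rw [one_div, Real.inv_rpow hr0.le, ← Real.rpow_neg hr0.le] at hs
      rw [div_le_iff₀ hφr] at hs ⊢
      rw [div_mul_eq_mul_div, div_mul_eq_mul_div, le_div_iff₀ hφ1]
      linarith
    rw [Real.norm_of_nonneg (by positivity)]
    calc r / (1 + r ^ 2) / φ r ≤ r / φ r := by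
          gcongr; exact div_le_self hr0.le (by nlinarith)
      _ = r * (1 / φ r) := by ring
      _ ≤ r * (a / φ 1 * r ^ (-σ₂)) := by gcongr
      _ = a / φ 1 * r ^ (1 - σ₂) := by
          rw [sub_eq_add_neg, Real.rpow_add hr0, Real.rpow_one]; ring
  · have hpow : IntegrableOn (fun r : ℝ => a / φ 1 * r ^ (-1 - σ₁)) (Ioi 1) volume :=
      (integrableOn_Ioi_rpow_of_lt (by linarith [hφ.σ₁_pos]) one_pos).const_mul _
    refine hpow.mono' (hmeas.mono_measure (Measure.restrict_mono (Ioi_subset_Ioi zero_le_one)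
      le_rfl)).aestronglyMeasurable ?_
    refine (ae_restrict_iff' measurableSet_Ioi).2 (Eventually.of_forall fun r hr => ?_)
    have hr1 : 1 < r := hr
    have hr0 : 0 < r := one_pos.trans hr1
    have hφr := hφ.pos r hr0
    have hs := (hφ.scaling 1 r one_pos hr1.le).1
    have hinv : 1 / φ r ≤ a / φ 1 * r ^ (-σ₁) := by
      rw [div_one, le_div_iff₀ hφ1] at hs
      have hp : 0 < r ^ σ₁ := Real.rpow_pos_of_pos hr0 _
      rw [Real.rpow_neg hr0.le]
      have h2 : 0 < a⁻¹ * r ^ σ₁ * φ 1 := by positivity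
      calc 1 / φ r ≤ 1 / (a⁻¹ * r ^ σ₁ * φ 1) := one_div_le_one_div_of_le h2 hs
        _ = a / φ 1 * (r ^ σ₁)⁻¹ := by field_simp
    rw [Real.norm_of_nonneg (by positivity)]
    calc r / (1 + r ^ 2) / φ r ≤ r⁻¹ / φ r := by
          gcongr
          rw [div_le_iff₀ (by positivity), inv_mul_eq_div, le_div_iff₀ hr0]; nlinarith
      _ = r⁻¹ * (1 / φ r) := by ring
      _ ≤ r⁻¹ * (a / φ 1 * r ^ (-σ₁)) := by gcongr
      _ = a / φ 1 * r ^ (-1 - σ₁) := by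
          rw [sub_eq_add_neg, Real.rpow_add hr0, Real.rpow_neg_one]; ring

/-- In polar coordinates the Jacobian `r^(n-1)` leaves exactly the integrand of
`integrableOn_scaling`. -/
theorem integrable_levyWeight_mul_refKernel [NeZero n] {φ : ℝ → ℝ} {a σ₁ σ₂ : ℝ}
    (hφ : WeakScaling φ a σ₁ σ₂) :
    Integrable (fun y : Rn n => levyWeight y * refKernel φ y) volume := by
  refine (integrable_fun_norm_addHaar volume
    (f := fun r : ℝ => r ^ 2 / (1 + r ^ 2) * (1 / (r ^ n * φ r)))).2 ?_
  refine (integrableOn_scaling hφ).congr_fun (fun r hr => ?_) measurableSet_Ioi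
  have hr0 : 0 < r := hr
  have hφr := hφ.pos r hr0
  obtain ⟨m, rfl⟩ := Nat.exists_eq_succ_of_ne_zero (NeZero.ne n)
  simp only [finrank_euclideanSpace, Fintype.card_fin, Nat.succ_eq_add_one,
    Nat.add_sub_cancel, smul_eq_mul]
  field_simp
  ring

/-- Since `1 - cos t ≤ min(t²/2, 2)`, its quotient by the Lévy weight is bounded. Without
integrability the integral in `normConst` would be `0` by default, and so would the constant. -/
theorem integrable_one_sub_cos_mul_refKernel [NeZero n] {φ : ℝ → ℝ} {a σ₁ σ₂ : ℝ}
    (hφ : WeakScaling φ a σ₁ σ₂) :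
    Integrable (fun y : Rn n => (1 - Real.cos (y 0)) / (‖y‖ ^ n * φ ‖y‖)) volume := by
  have h := integrable_levyWeight_mul_refKernel (n := n) hφ
  have hb := integrable_bounded_mul (C := 4)
    (g := fun y : Rn n => (1 - Real.cos (y 0)) * (1 + ‖y‖ ^ 2) / ‖y‖ ^ 2)
    (Measurable.aemeasurable (by fun_prop)) (fun y => ?_) h
  · refine hb.congr ?_
    filter_upwards [compl_mem_ae_iff.2 (measure_singleton (0 : Rn n))] with y hy
    have hy0 : 0 < ‖y‖ := norm_pos_iff.2 hy
    have := hφ.pos _ hy0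
    simp only [levyWeight, refKernel]
    field_simp
  · have hc := Real.one_sub_sq_div_two_le_cos (x := y 0)
    have hc1 := Real.neg_one_le_cos (y 0)
    have hc2 := Real.cos_le_one (y 0)
    have hy : (y 0) ^ 2 ≤ ‖y‖ ^ 2 := by
      have h1 := PiLp.norm_apply_le y 0
      rw [Real.norm_eq_abs] at h1
      rw [← sq_abs (y 0)]
      gcongr
    rw [abs_of_nonneg (div_nonneg (mul_nonneg (by linarith) (by positivity)) (by positivity))]
    rcases (sq_nonneg ‖y‖).eq_or_lt with h0 | h0
    · rw [← h0]; norm_num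
    · rw [div_le_iff₀ h0]
      nlinarith

theorem normConst_pos [NeZero n] {φ : ℝ → ℝ} {a σ₁ σ₂ : ℝ} (hφ : WeakScaling φ a σ₁ σ₂) :
    0 < normConst n φ := by
  unfold normConst
  refine inv_pos.2 ?_
  have hnn : ∀ y : Rn n, 0 ≤ (1 - Real.cos (y 0)) / (‖y‖ ^ n * φ ‖y‖) := by
    intro y
    rcases eq_or_ne y 0 with rfl | hy
    · simp
    · have hy0 : 0 < ‖y‖ := norm_pos_iff.2 hy
      have := hφ.pos _ hy0
      exact div_nonneg (by linarith [Real.cos_le_one (y 0)]) (by positivity)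
  rw [integral_pos_iff_support_of_nonneg hnn (integrable_one_sub_cos_mul_refKernel hφ)]
  let U : Set (Rn n) := {y | Real.cos (y 0) < 1}
  have hU : IsOpen U := isOpen_lt (by fun_prop) continuous_const
  have hUne : U.Nonempty := ⟨EuclideanSpace.single 0 Real.pi, by simp [U]⟩
  refine (hU.measure_pos volume hUne).trans_le (measure_mono fun y hy => ?_)
  have hy' : Real.cos (y 0) < 1 := hy
  have hy1 : y ≠ 0 := by rintro rfl; simp at hy'
  have hy0 : 0 < ‖y‖ := norm_pos_iff.2 hy1
  have := hφ.pos _ hy0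
  exact (div_pos (by linarith) (by positivity)).ne'

/-! ### The tail and core parts of the reference kernel. -/

/-- The reference kernel restricted to `{|y| ≥ ρ}`. -/
def tailKernel (φ : ℝ → ℝ) (ρ : ℝ) : Rn n → ℝ :=
  {y : Rn n | ρ ≤ ‖y‖}.indicator (refKernel φ)

/-- The function `|y|²` times the reference kernel, restricted to `{|y| < r}`. -/
def coreKernel (φ : ℝ → ℝ) (r : ℝ) : Rn n → ℝ :=
  {y : Rn n | ‖y‖ < r}.indicator (fun y => ‖y‖ ^ 2 * refKernel φ y)

theorem measurableSet_le_norm (ρ : ℝ) : MeasurableSet {y : Rn n | ρ ≤ ‖y‖} :=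
  measurableSet_le measurable_const measurable_norm

theorem measurableSet_norm_lt (r : ℝ) : MeasurableSet {y : Rn n | ‖y‖ < r} :=
  measurableSet_lt measurable_norm measurable_const

section Kernels

variable {φ : ℝ → ℝ} {a σ₁ σ₂ : ℝ}

theorem refKernel_nonneg (hφ : WeakScaling φ a σ₁ σ₂) [NeZero n] (y : Rn n) :
    0 ≤ refKernel φ y := by
  rcases eq_or_ne y 0 with rfl | hy
  -- The sign of `φ 0` is unknown, but `‖0‖ ^ n = 0` and division by zero give the value `0`.
  · simp [refKernel, NeZero.ne n]
  · exact (refKernel_pos hφ hy).le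

theorem tailKernel_nonneg [NeZero n] (hφ : WeakScaling φ a σ₁ σ₂) (ρ : ℝ) (y : Rn n) :
    0 ≤ tailKernel φ ρ y :=
  indicator_nonneg (fun y _ => refKernel_nonneg hφ y) y

theorem tailKernel_neg (ρ : ℝ) (y : Rn n) : tailKernel φ ρ (-y) = tailKernel φ ρ y := by
  simp [tailKernel, indicator, refKernel]

theorem integrable_tailKernel [NeZero n] (hφ : WeakScaling φ a σ₁ σ₂) {ρ : ℝ} (hρ : 0 < ρ) :
    Integrable (tailKernel φ ρ : Rn n → ℝ) volume := by
  have hb := integrable_bounded_mul (C := (1 + ρ ^ 2) / ρ ^ 2)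
    (g := {y : Rn n | ρ ≤ ‖y‖}.indicator fun y => (1 + ‖y‖ ^ 2) / ‖y‖ ^ 2)
    (Measurable.aemeasurable ((by fun_prop : Measurable fun y : Rn n =>
      (1 + ‖y‖ ^ 2) / ‖y‖ ^ 2).indicator (measurableSet_le_norm ρ)))
    (fun y => ?_) (integrable_levyWeight_mul_refKernel (n := n) hφ)
  · refine hb.congr (Eventually.of_forall fun y => ?_)
    by_cases hy : ρ ≤ ‖y‖
    · have hy0 : 0 < ‖y‖ := hρ.trans_le hy
      simp only [tailKernel, indicator, mem_ofPred_eq, hy, if_true, levyWeight]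
      field_simp
    · simp [tailKernel, indicator, hy]
  · by_cases hy : ρ ≤ ‖y‖
    · have hy0 : 0 < ‖y‖ := hρ.trans_le hy
      simp only [indicator, mem_ofPred_eq, hy, if_true]
      rw [abs_of_nonneg (by positivity), add_div, add_div, div_self (by positivity),
        div_self (by positivity)]
      gcongr
    · simp only [indicator, mem_ofPred_eq, hy, if_false, abs_zero]
      positivity

theorem integral_tailKernel_pos [NeZero n] (hφ : WeakScaling φ a σ₁ σ₂) {ρ : ℝ} (hρ : 0 < ρ) :
    0 < ∫ y : Rn n, tailKernel φ ρ y := by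
  rw [integral_pos_iff_support_of_nonneg (fun y => tailKernel_nonneg hφ ρ y)
    (integrable_tailKernel hφ hρ)]
  have hU : IsOpen {y : Rn n | ρ < ‖y‖} := isOpen_lt continuous_const continuous_norm
  have hUne : {y : Rn n | ρ < ‖y‖}.Nonempty :=
    ⟨EuclideanSpace.single 0 (ρ + 1), by
      simp only [mem_ofPred_eq, PiLp.norm_single, Real.norm_eq_abs]
      linarith [le_abs_self (ρ + 1)]⟩
  refine (hU.measure_pos volume hUne).trans_le (measure_mono fun y hy => ?_)
  have hy' : ρ < ‖y‖ := hy
  have : tailKernel φ ρ y = refKernel φ y := indicator_of_mem (by exact hy'.le) _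
  rw [Function.mem_support, this]
  exact (refKernel_pos hφ (norm_pos_iff.1 (hρ.trans hy'))).ne'

/-- Measurability is read off from the integrable product with the Lévy weight, which is then
divided out away from the origin. -/
theorem aestronglyMeasurable_refKernel [NeZero n] (hφ : WeakScaling φ a σ₁ σ₂) :
    AEStronglyMeasurable (refKernel φ : Rn n → ℝ) volume := by
  have h := (Measurable.aestronglyMeasurable (μ := volume)
    (by fun_prop : Measurable fun y : Rn n => (1 + ‖y‖ ^ 2) / ‖y‖ ^ 2)).mul
    (integrable_levyWeight_mul_refKernel (n := n) hφ).aestronglyMeasurable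
  refine h.congr ?_
  filter_upwards [compl_mem_ae_iff.2 (measure_singleton (0 : Rn n))] with y hy
  have hy0 : 0 < ‖y‖ := norm_pos_iff.2 hy
  simp only [Pi.mul_apply, levyWeight]
  field_simp

theorem aestronglyMeasurable_coreKernel [NeZero n] (hφ : WeakScaling φ a σ₁ σ₂) (r : ℝ) :
    AEStronglyMeasurable (coreKernel φ r : Rn n → ℝ) volume :=
  ((Measurable.aestronglyMeasurable (by fun_prop)).mul
    (aestronglyMeasurable_refKernel hφ)).indicator (measurableSet_norm_lt r)

theorem norm_coreKernel_le [NeZero n] (hφ : WeakScaling φ a σ₁ σ₂) {r ρ : ℝ} (hrρ : r ≤ ρ)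
    (y : Rn n) : ‖coreKernel φ r y‖ ≤ (1 + ρ ^ 2) * (levyWeight y * refKernel φ y) := by
  have hk := refKernel_nonneg hφ y
  by_cases hy : ‖y‖ < r
  · have hle : ‖y‖ ^ 2 ≤ ρ ^ 2 := by
      have := norm_nonneg y
      gcongr
      linarith
    simp only [coreKernel, indicator, mem_ofPred_eq, hy, if_true, levyWeight]
    rw [Real.norm_of_nonneg (by positivity), ← mul_assoc]
    gcongr
    rw [← mul_div_assoc, le_div_iff₀ (by positivity), mul_comm]
    gcongr
  · simp only [coreKernel, indicator, mem_ofPred_eq, hy, if_false, norm_zero]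
    have := levyWeight_nonneg y
    positivity

theorem integrable_coreKernel [NeZero n] (hφ : WeakScaling φ a σ₁ σ₂) (r : ℝ) :
    Integrable (coreKernel φ r : Rn n → ℝ) volume :=
  ((integrable_levyWeight_mul_refKernel hφ).const_mul (1 + r ^ 2)).mono'
    (aestronglyMeasurable_coreKernel hφ r) (Eventually.of_forall (norm_coreKernel_le hφ le_rfl))

theorem tendsto_integral_coreKernel [NeZero n] (hφ : WeakScaling φ a σ₁ σ₂) {ρ : ℝ} (hρ : 0 < ρ) :
    Tendsto (fun j : ℕ => ∫ y : Rn n, coreKernel φ (ρ / (j + 1)) y) atTop (𝓝 0) := by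
  have hlim : Tendsto (fun j : ℕ => ρ / ((j : ℝ) + 1)) atTop (𝓝 0) :=
    tendsto_const_nhds.div_atTop
      (tendsto_atTop_add_const_right _ _ tendsto_natCast_atTop_atTop)
  have h := tendsto_integral_of_dominated_convergence
    (F := fun (j : ℕ) (y : Rn n) => coreKernel φ (ρ / (j + 1)) y) (f := fun _ => (0 : ℝ))
    (fun y => (1 + ρ ^ 2) * (levyWeight y * refKernel φ y))
    (fun j => aestronglyMeasurable_coreKernel hφ _)
    ((integrable_levyWeight_mul_refKernel hφ).const_mul _)
    (fun j => Eventually.of_forall (norm_coreKernel_le hφ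
      (div_le_self hρ.le (by linarith [(Nat.cast_nonneg j : (0 : ℝ) ≤ j)]))))
    (Eventually.of_forall fun y => ?_)
  · simpa using h
  · refine tendsto_const_nhds.congr' ?_
    rcases eq_or_ne y 0 with rfl | hy
    · exact Eventually.of_forall fun j => by simp [coreKernel, indicator]
    · filter_upwards [hlim.eventually_lt_const (norm_pos_iff.2 hy)] with j hj
      simp [coreKernel, indicator, hj.le]

/-! ### The upper bound for operators of the class. -/

/-- Upper bound for a linear operator of the class at a point where the second difference is
quadratic near the point and one-sidedly controlled away from it. -/
theorem linOp_le_of_secondDiff_le [NeZero n] (hφ : WeakScaling φ a σ₁ σ₂) {lam Lam : ℝ}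
    (hlam : 0 < lam) {K F e : Rn n → ℝ} (hK : K ∈ classL0 n φ lam Lam) (hF : IsBoundedFun F)
    {A r ρ D m : ℝ} (hA : 0 ≤ A) (hr : 0 < r) (hrρ : r ≤ ρ) (hρD : ρ ≤ D) (hm : 0 ≤ m)
    (he : ∀ z, 0 ≤ e z) (hei : Integrable (fun z => e z * tailKernel φ ρ z) volume)
    (hnear : ∀ z, ‖z‖ < r → F z + F (-z) - 2 * F 0 = A * ‖z‖ ^ 2)
    (hmid : ∀ z, r ≤ ‖z‖ → ‖z‖ < ρ → F z ≤ F 0)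
    (hfar : ∀ z, ρ ≤ ‖z‖ → F z - F 0 ≤ e z)
    (hout : ∀ z, D ≤ ‖z‖ → F z - F 0 ≤ e z - m) :
    linOp K F 0 ≤ normConst n φ * Lam * (A * (∫ z : Rn n, coreKernel φ r z)
      + 2 * ∫ z, e z * tailKernel φ ρ z)
      - 2 * m * (normConst n φ * lam) * ∫ z : Rn n, tailKernel φ D z := by
  obtain ⟨hKm, -, hKi, hKb⟩ := hK
  obtain ⟨hFm, C, hC⟩ := hF
  have hC0 : 0 ≤ C := (abs_nonneg _).trans (hC 0)
  have hN := normConst_pos (n := n) hφ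
  have hρ := hr.trans_le hrρ
  have hsd : ∀ z, secondDiff F 0 z = F z + F (-z) - 2 * F 0 := fun z => by simp [secondDiff]
  -- Genuine integrability is required for the comparison of integrals. The second difference is
  -- dominated by the Lévy weight: `A‖z‖²` for `‖z‖ < r`, and `4C` beyond, which accounts for the
  -- two summands in `B`.
  have hint : Integrable (fun z => secondDiff F 0 z * K z) volume := by
    have hrr : 0 < r ^ 2 := by positivity
    let B := (A + 4 * C / r ^ 2) * (1 + r ^ 2)
    have hB : ∀ z, |secondDiff F 0 z| ≤ B * levyWeight z := by
      intro z
      rw [hsd z]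
      have hz2 : 0 < 1 + ‖z‖ ^ 2 := by positivity
      simp only [B, levyWeight]
      rw [← mul_div_assoc, le_div_iff₀ hz2]
      by_cases hz : ‖z‖ < r
      · rw [hnear z hz, abs_of_nonneg (by positivity)]
        have : ‖z‖ ^ 2 ≤ r ^ 2 := by gcongr
        calc A * ‖z‖ ^ 2 * (1 + ‖z‖ ^ 2) ≤ A * ‖z‖ ^ 2 * (1 + r ^ 2) := by gcongr
          _ = A * (1 + r ^ 2) * ‖z‖ ^ 2 := by ring
          _ ≤ (A + 4 * C / r ^ 2) * (1 + r ^ 2) * ‖z‖ ^ 2 := by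
            gcongr
            exact le_add_of_nonneg_right (by positivity)
      · have hz' : r ^ 2 ≤ ‖z‖ ^ 2 := by gcongr; exact not_lt.1 hz
        have h4 : |F z + F (-z) - 2 * F 0| ≤ 4 * C := by
          have h1 := abs_le.1 (hC z)
          have h2 := abs_le.1 (hC (-z))
          have h3 := abs_le.1 (hC 0)
          exact abs_le.2 ⟨by linarith [h1.1, h2.1, h3.2], by linarith [h1.2, h2.2, h3.1]⟩
        calc |F z + F (-z) - 2 * F 0| * (1 + ‖z‖ ^ 2) ≤ 4 * C * (1 + ‖z‖ ^ 2) := by gcongr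
          _ ≤ 4 * C * ((1 + r ^ 2) / r ^ 2 * ‖z‖ ^ 2) := by
            gcongr
            rw [div_mul_eq_mul_div, le_div_iff₀ hrr]
            nlinarith
          _ = 4 * C / r ^ 2 * (1 + r ^ 2) * ‖z‖ ^ 2 := by ring
          _ ≤ (A + 4 * C / r ^ 2) * (1 + r ^ 2) * ‖z‖ ^ 2 := by
            gcongr
            exact le_add_of_nonneg_left hA
    have hm1 : AEMeasurable (fun z => secondDiff F 0 z) volume := by
      have : (fun z => secondDiff F 0 z) = fun z => F z + F (-z) - 2 * F 0 := funext hsd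
      rw [this]
      exact (hFm.add (aemeasurable_reflect hFm)).sub aemeasurable_const
    refine (hKi.norm.const_mul B).mono' (hm1.mul hKm).aestronglyMeasurable
      (Eventually.of_forall fun z => ?_)
    rw [norm_mul, norm_mul, ← mul_assoc]
    have hq : ‖‖z‖ ^ 2 / (1 + ‖z‖ ^ 2)‖ = levyWeight z := Real.norm_of_nonneg (levyWeight_nonneg z)
    rw [hq]
    exact mul_le_mul_of_nonneg_right (hB z) (norm_nonneg _)
  have hei' : Integrable (fun z => e (-z) * tailKernel φ ρ z) volume := by
    simpa only [tailKernel_neg] using hei.comp_neg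
  have heq : ∫ z, e (-z) * tailKernel φ ρ z = ∫ z, e z * tailKernel φ ρ z := by
    simpa only [tailKernel_neg] using integral_neg_eq_self (fun z => e z * tailKernel φ ρ z) volume
  have hc := integrable_coreKernel (n := n) hφ r
  have hD := integrable_tailKernel (n := n) hφ (hρ.trans_le hρD)
  have hcA := hc.const_mul A
  have hee : Integrable (fun z => e z * tailKernel φ ρ z + e (-z) * tailKernel φ ρ z) volume :=
    hei.add hei'
  have hce : Integrable (fun z => A * coreKernel φ r z +
      (e z * tailKernel φ ρ z + e (-z) * tailKernel φ ρ z)) volume := hcA.add hee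
  have hRi : Integrable (fun z => normConst n φ * Lam * (A * coreKernel φ r z +
      (e z * tailKernel φ ρ z + e (-z) * tailKernel φ ρ z)) -
      2 * m * (normConst n φ * lam) * tailKernel φ D z) volume :=
    (hce.const_mul _).sub (hD.const_mul _)
  have hmono := integral_mono_ae hint hRi (by
    filter_upwards [compl_mem_ae_iff.2 (measure_singleton (0 : Rn n))] with z hz
    have hz0 : z ≠ 0 := hz
    have hk := refKernel_pos hφ hz0
    have hKl : normConst n φ * lam * refKernel φ z ≤ K z := by
      have := (hKb z hz0).1
      rwa [div_eq_mul_one_div, ← mul_assoc] at this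
    have hKu : K z ≤ normConst n φ * Lam * refKernel φ z := by
      have := (hKb z hz0).2
      rwa [div_eq_mul_one_div, ← mul_assoc] at this
    have hKp : 0 ≤ K z := le_trans (by positivity) hKl
    rw [hsd z]
    have hez := he z
    have hez' := he (-z)
    by_cases h1 : ‖z‖ < r
    · have h2 : ¬ ρ ≤ ‖z‖ := by linarith
      have h3 : ¬ D ≤ ‖z‖ := by linarith
      simp only [coreKernel, tailKernel, indicator, mem_ofPred_eq, h1, h2, h3, if_true, if_false]
      rw [hnear z h1]
      have : A * ‖z‖ ^ 2 * K z ≤ A * ‖z‖ ^ 2 * (normConst n φ * Lam * refKernel φ z) := by gcongr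
      linarith
    · by_cases h2 : ρ ≤ ‖z‖
      · by_cases h3 : D ≤ ‖z‖
        · simp only [coreKernel, tailKernel, indicator, mem_ofPred_eq, h1, h2, h3, if_true,
            if_false]
          have g1 := hout z h3
          have g2 := hout (-z) (by rwa [norm_neg])
          -- The nonnegative error takes the upper bound on `K`, the gain `-2m` the lower bound.
          have e1 : (F z + F (-z) - 2 * F 0) * K z ≤ (e z + e (-z) - 2 * m) * K z :=
            mul_le_mul_of_nonneg_right (by linarith) hKp
          have e2 : (e z + e (-z)) * K z ≤
              (e z + e (-z)) * (normConst n φ * Lam * refKernel φ z) := by gcongr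
          have e3 : 2 * m * (normConst n φ * lam * refKernel φ z) ≤ 2 * m * K z := by gcongr
          linarith
        · simp only [coreKernel, tailKernel, indicator, mem_ofPred_eq, h1, h2, h3, if_true,
            if_false]
          have g1 := hfar z h2
          have g2 := hfar (-z) (by rwa [norm_neg])
          have e1 : (F z + F (-z) - 2 * F 0) * K z ≤ (e z + e (-z)) * K z := by
            gcongr; linarith
          have e2 : (e z + e (-z)) * K z ≤
              (e z + e (-z)) * (normConst n φ * Lam * refKernel φ z) := by gcongr
          linarith
      · have h3 : ¬ D ≤ ‖z‖ := by linarith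
        simp only [coreKernel, tailKernel, indicator, mem_ofPred_eq, h1, h2, h3, if_false]
        have g1 := hmid z (not_lt.1 h1) (not_le.1 h2)
        have g2 := hmid (-z) (by rw [norm_neg]; exact not_lt.1 h1)
          (by rw [norm_neg]; exact not_le.1 h2)
        have := mul_nonneg (by linarith : 0 ≤ 2 * F 0 - F z - F (-z)) hKp
        linarith)
  refine hmono.trans (le_of_eq ?_)
  rw [integral_sub (hce.const_mul _) (hD.const_mul _), integral_const_mul, integral_const_mul,
    integral_add hcA hee, integral_add hei hei', heq, integral_const_mul]
  ring

end Kernels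

/-! ### Doubling of variables. -/

/-- Doubling of variables: maximizers of the penalized differences `u(x) - v(y) - c |x - y|²` on a
compact set converge, along a subsequence, to a diagonal point. -/
theorem exists_doubling_sequence {S : Set (Rn n)} (hS : IsCompact S) {u v : Rn n → ℝ}
    (hu : UpperSemicontinuousOn u S) (hv : LowerSemicontinuousOn v S) {C : ℝ}
    (huC : ∀ x, |u x| ≤ C) (hvC : ∀ x, |v x| ≤ C) {p : Rn n} (hp : p ∈ S) :
    ∃ (c : ℕ → ℝ) (x y : ℕ → Rn n) (q : Rn n), (∀ k, 0 ≤ c k) ∧ (∀ k, x k ∈ S) ∧ (∀ k, y k ∈ S) ∧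
      q ∈ S ∧ Tendsto x atTop (𝓝 q) ∧ Tendsto y atTop (𝓝 q) ∧
      (∀ k, u p - v p ≤ u (x k) - v (y k)) ∧ u p - v p ≤ u q - v q ∧
      ∀ k, ∀ x' ∈ S, ∀ y' ∈ S, u x' - v y' - c k * ‖x' - y'‖ ^ 2 ≤
        u (x k) - v (y k) - c k * ‖x k - y k‖ ^ 2 := by
  have hSS : IsCompact (S ×ˢ S) := hS.prod hS
  have hex : ∀ k : ℕ, ∃ w ∈ S ×ˢ S, IsMaxOn
      (fun w : Rn n × Rn n => u w.1 + -v w.2 + -((k : ℝ) * ‖w.1 - w.2‖ ^ 2)) (S ×ˢ S) w := by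
    intro k
    refine UpperSemicontinuousOn.exists_isMaxOn ⟨(p, p), hp, hp⟩ hSS ?_
    refine UpperSemicontinuousOn.add (UpperSemicontinuousOn.add ?_ ?_) ?_
    · exact hu.comp continuous_fst.continuousOn fun w hw => hw.1
    · intro w hw b hb
      have h := (hv.comp (t := S ×ˢ S) continuous_snd.continuousOn fun w hw => hw.2) w hw (-b)
        (by simp only [Function.comp_apply]; linarith)
      filter_upwards [h] with z hz
      simp only [Function.comp_apply] at hz
      linarith
    · exact (by fun_prop : Continuous fun w : Rn n × Rn n =>
        -((k : ℝ) * ‖w.1 - w.2‖ ^ 2)).continuousOn.upperSemicontinuousOn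
  choose w hwS hwmax using hex
  obtain ⟨⟨q, q'⟩, hq, θ, hθ, hlim⟩ := hSS.tendsto_subseq hwS
  have hx : Tendsto (fun k => (w (θ k)).1) atTop (𝓝 q) := (continuous_fst.tendsto _).comp hlim
  have hy : Tendsto (fun k => (w (θ k)).2) atTop (𝓝 q') := (continuous_snd.tendsto _).comp hlim
  have hmax : ∀ k : ℕ, ∀ x' ∈ S, ∀ y' ∈ S, u x' - v y' - (k : ℝ) * ‖x' - y'‖ ^ 2 ≤
      u (w k).1 - v (w k).2 - (k : ℝ) * ‖(w k).1 - (w k).2‖ ^ 2 := by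
    intro k x' hx' y' hy'
    have := hwmax k (show (x', y') ∈ S ×ˢ S from ⟨hx', hy'⟩)
    simp only [mem_ofPred_eq] at this
    linarith
  have hmp : ∀ k : ℕ, u p - v p ≤
      u (w k).1 - v (w k).2 - (k : ℝ) * ‖(w k).1 - (w k).2‖ ^ 2 := by
    intro k
    have := hmax k p hp p hp
    simpa using this
  -- The maximum is at least the value at `(p, p)`, where the penalty vanishes; dividing by `k` then
  -- forces the two limits to coincide.
  have hpen : ∀ k : ℕ, (k : ℝ) * ‖(w k).1 - (w k).2‖ ^ 2 ≤ 4 * C := by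
    intro k
    have h0 := hmp k
    have h1 := abs_le.1 (huC p)
    have h2 := abs_le.1 (hvC p)
    have h3 := abs_le.1 (huC (w k).1)
    have h4 := abs_le.1 (hvC (w k).2)
    linarith [h1.1, h2.2, h3.2, h4.1]
  have hqq : q = q' := by
    have hd : Tendsto (fun k => ‖(w (θ k)).1 - (w (θ k)).2‖ ^ 2) atTop (𝓝 (‖q - q'‖ ^ 2)) :=
      ((hx.sub hy).norm).pow 2
    have hz : Tendsto (fun k => ‖(w (θ k)).1 - (w (θ k)).2‖ ^ 2) atTop (𝓝 0) := by
      have hb : Tendsto (fun k : ℕ => 4 * C / (θ k : ℝ)) atTop (𝓝 0) :=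
        tendsto_const_nhds.div_atTop (tendsto_natCast_atTop_atTop.comp hθ.tendsto_atTop)
      refine squeeze_zero' (Eventually.of_forall fun k => by positivity) ?_ hb
      filter_upwards [hθ.tendsto_atTop.eventually_gt_atTop 0] with k hk
      rw [le_div_iff₀ (by exact_mod_cast hk), mul_comm]
      exact hpen (θ k)
    have h0 := tendsto_nhds_unique hd hz
    have h1 : ‖q - q'‖ = 0 := by simpa using h0
    exact sub_eq_zero.1 (norm_eq_zero.1 h1)
  subst hqq
  have hmp' : ∀ k, u p - v p ≤ u (w k).1 - v (w k).2 := by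
    intro k
    have h0 := hmp k
    have h1 : 0 ≤ (k : ℝ) * ‖(w k).1 - (w k).2‖ ^ 2 := by positivity
    linarith
  refine ⟨fun k => (θ k : ℝ), fun k => (w (θ k)).1, fun k => (w (θ k)).2, q,
    fun k => Nat.cast_nonneg _, fun k => (hwS _).1, fun k => (hwS _).2, hq.1, hx, hy,
    fun k => hmp' _, ?_, fun k => hmax (θ k)⟩
  by_contra! hlt
  -- Half the gap is allotted to each function: semicontinuity makes `u < u q + η` and `v > v q - η`
  -- near `q`, which contradicts `hmp'`.
  let η := (u p - v p - (u q - v q)) / 2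
  have hη : 0 < η := by simp only [η]; linarith
  have hxS : Tendsto (fun k => (w (θ k)).1) atTop (𝓝[S] q) :=
    tendsto_nhdsWithin_iff.2 ⟨hx, Eventually.of_forall fun k => (hwS _).1⟩
  have hyS : Tendsto (fun k => (w (θ k)).2) atTop (𝓝[S] q) :=
    tendsto_nhdsWithin_iff.2 ⟨hy, Eventually.of_forall fun k => (hwS _).2⟩
  obtain ⟨k, h1, h2⟩ := ((hxS.eventually (hu q hq.1 (u q + η) (by linarith))).and
    (hyS.eventually (hv q hq.2 (v q - η) (by linarith)))).exists
  have := hmp' (θ k)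
  simp only [η] at h1 h2
  linarith

/-! ### Quadratic test functions and gluing. -/

/-- The quadratic test function with value `α` at `x`. -/
def paraboloid (α c s : ℝ) (x y : Rn n) : Rn n → ℝ :=
  fun z => α + c * (‖z - y‖ ^ 2 - ‖x - y‖ ^ 2) + s * ‖z - x‖ ^ 2

@[simp]
theorem paraboloid_self (α c s : ℝ) (x y : Rn n) : paraboloid α c s x y x = α := by
  simp [paraboloid]

theorem contDiff_paraboloid (α c s : ℝ) (x y : Rn n) : ContDiff ℝ 2 (paraboloid α c s x y) := by
  unfold paraboloid
  exact (contDiff_const.add (contDiff_const.mul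
    (((contDiff_id.sub contDiff_const).norm_sq ℝ).sub contDiff_const))).add
    (contDiff_const.mul ((contDiff_id.sub contDiff_const).norm_sq ℝ))

/-- The linear term is odd in `z`, so a symmetric second difference retains only `2(c + s)‖z‖²`. -/
theorem paraboloid_add (α c s : ℝ) (x y z : Rn n) :
    paraboloid α c s x y (x + z) = α + 2 * c * inner ℝ (x - y) z + (c + s) * ‖z‖ ^ 2 := by
  have h1 : x + z - y = (x - y) + z := by abel
  have h2 : x + z - x = z := by abel
  simp only [paraboloid]
  rw [h1, h2, norm_add_sq_real]
  ring

theorem glue_of_mem {N : Set (Rn n)} {z : Rn n} (h : z ∈ N) (ψ u : Rn n → ℝ) :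
    glue N ψ u z = ψ z := by
  simp [glue, h]

theorem glue_of_notMem {N : Set (Rn n)} {z : Rn n} (h : z ∉ N) (ψ u : Rn n → ℝ) :
    glue N ψ u z = u z := by
  simp [glue, h]

theorem isBoundedFun_glue_ball {u ψ : Rn n → ℝ} (hu : IsBoundedFun u) (hψ : Continuous ψ)
    (x : Rn n) (r : ℝ) : IsBoundedFun (glue (Metric.ball x r) ψ u) := by
  obtain ⟨hm, C, hC⟩ := hu
  refine ⟨?_, ?_⟩
  · have h : glue (Metric.ball x r) ψ u =
        (Metric.ball x r).indicator ψ + (Metric.ball x r)ᶜ.indicator u := by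
      funext z
      by_cases hz : z ∈ Metric.ball x r <;> simp only [glue, hz, Pi.add_apply, indicator,
        mem_compl_iff, not_true, not_false_iff, if_true, if_false, add_zero, zero_add]
    rw [h]
    exact (hψ.measurable.indicator measurableSet_ball).aemeasurable.add
      (hm.indicator measurableSet_ball.compl)
  · obtain ⟨C', hC'⟩ := (isCompact_closedBall x r).exists_bound_of_continuousOn hψ.continuousOn
    refine ⟨max C C', fun z => ?_⟩
    by_cases hz : z ∈ Metric.ball x r
    · rw [glue_of_mem hz]
      exact (hC' z (Metric.ball_subset_closedBall hz)).trans (le_max_right _ _)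
    · rw [glue_of_notMem hz]
      exact (hC z).trans (le_max_left _ _)

theorem isBoundedFun_translate {u : Rn n → ℝ} (hu : IsBoundedFun u) (x : Rn n) :
    IsBoundedFun fun z => u (z + x) := by
  obtain ⟨hm, C, hC⟩ := hu
  refine ⟨?_, C, fun z => hC _⟩
  simpa only [add_comm] using aemeasurable_translate hm x

theorem c11At_translate {u : Rn n → ℝ} {x : Rn n} (hu : C11At u x) :
    C11At (fun z => u (z + x)) 0 := by
  obtain ⟨p, M, hM, h⟩ := hu
  refine ⟨p, M, hM, ?_⟩
  filter_upwards [h] with y hy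
  simpa [add_comm] using hy

theorem c11At_glue_paraboloid (u : Rn n → ℝ) (α c s : ℝ) (x y : Rn n) {r : ℝ} (hr : 0 < r) :
    C11At (glue (Metric.ball x r) (paraboloid α c s x y) u) x := by
  refine ⟨(2 * c) • (x - y), |c + s| + 1, by positivity, ?_⟩
  filter_upwards [Metric.ball_mem_nhds (0 : Rn n) hr] with z hz
  have hz' : x + z ∈ Metric.ball x r := by simpa using hz
  rw [glue_of_mem hz', glue_of_mem (Metric.mem_ball_self hr), paraboloid_add, paraboloid_self,
    real_inner_smul_left]
  have : α + 2 * c * inner ℝ (x - y) z + (c + s) * ‖z‖ ^ 2 - α - 2 * c * inner ℝ (x - y) z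
      = (c + s) * ‖z‖ ^ 2 := by ring
  rw [this, abs_mul, abs_of_nonneg (sq_nonneg ‖z‖)]
  gcongr
  linarith

/-! ### The error of shifting the base points to `q`. -/

theorem isBoundedFun_indicator_one {U : Set (Rn n)} (hU : IsOpen U) :
    IsBoundedFun (U.indicator fun _ => (1 : ℝ)) := by
  refine ⟨(measurable_const.indicator hU.measurableSet).aemeasurable, 1, fun x => ?_⟩
  by_cases hx : x ∈ U <;> simp [hx]

/-- Crossing the boundary of `U` is thereby charged to an error that is small in weighted `L¹`, with
no regularity of the boundary. -/
theorem one_le_abs_indicator_sub {U : Set (Rn n)} {x y : Rn n} (hx : x ∉ U) (hy : y ∈ U) :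
    1 ≤ |U.indicator (fun _ => (1 : ℝ)) x - U.indicator (fun _ => (1 : ℝ)) y| := by
  simp [hx, hy]

/-- The error in comparing `u(x + z) - v(y + z)` with `u(q + z) - v(q + z)`, including the error
made in replacing `x + z ∈ U` and `y + z ∈ U` by `q + z ∈ U`. -/
def shiftError (u v : Rn n → ℝ) (U : Set (Rn n)) (C : ℝ) (q x y z : Rn n) : ℝ :=
  |u (x + z) - u (q + z)| + |v (y + z) - v (q + z)| +
    2 * C * (|U.indicator (fun _ => (1 : ℝ)) (x + z) - U.indicator (fun _ => (1 : ℝ)) (q + z)| +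
      |U.indicator (fun _ => (1 : ℝ)) (y + z) - U.indicator (fun _ => (1 : ℝ)) (q + z)|)

theorem shiftError_nonneg (u v : Rn n → ℝ) (U : Set (Rn n)) {C : ℝ} (hC : 0 ≤ C) (q x y z : Rn n) :
    0 ≤ shiftError u v U C q x y z := by
  unfold shiftError; positivity

section ShiftError

variable {u v h : Rn n → ℝ} {U : Set (Rn n)}

theorem integrable_shiftError_mul (hu : IsBoundedFun u) (hv : IsBoundedFun v) (hU : IsOpen U)
    (hh : Integrable h volume) (C : ℝ) (q x y : Rn n) :
    Integrable (fun z => shiftError u v U C q x y z * h z) volume := by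
  have h1 := integrable_abs_translate_sub_mul hu hh x q
  have h2 := integrable_abs_translate_sub_mul hv hh y q
  have h3 := integrable_abs_translate_sub_mul (isBoundedFun_indicator_one hU) hh x q
  have h4 := integrable_abs_translate_sub_mul (isBoundedFun_indicator_one hU) hh y q
  refine ((h1.add h2).add ((h3.add h4).const_mul (2 * C))).congr (Eventually.of_forall fun z => ?_)
  simp only [Pi.add_apply, shiftError]
  ring

theorem tendsto_integral_shiftError_mul (hu : IsBoundedFun u) (hv : IsBoundedFun v) (hU : IsOpen U)
    (hh : Integrable h volume) (hh0 : ∀ z, 0 ≤ h z) (C : ℝ) {q : Rn n} {x y : ℕ → Rn n}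
    (hx : Tendsto x atTop (𝓝 q)) (hy : Tendsto y atTop (𝓝 q)) :
    Tendsto (fun k => ∫ z, shiftError u v U C q (x k) (y k) z * h z) atTop (𝓝 0) := by
  have hb := isBoundedFun_indicator_one hU
  have t1 := tendsto_integral_abs_translate_sub_mul hu hh hh0 hx
  have t2 := tendsto_integral_abs_translate_sub_mul hv hh hh0 hy
  have t3 := tendsto_integral_abs_translate_sub_mul hb hh hh0 hx
  have t4 := tendsto_integral_abs_translate_sub_mul hb hh hh0 hy
  have t := (t1.add t2).add ((t3.add t4).const_mul (2 * C))
  simp only [add_zero, mul_zero] at t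
  refine t.congr fun k => ?_
  have h1 := integrable_abs_translate_sub_mul hu hh (x k) q
  have h2 := integrable_abs_translate_sub_mul hv hh (y k) q
  have h3 := integrable_abs_translate_sub_mul hb hh (x k) q
  have h4 := integrable_abs_translate_sub_mul hb hh (y k) q
  have e1 := integral_add (h1.add h2) ((h3.add h4).const_mul (2 * C))
  simp only [Pi.add_apply] at e1
  rw [← integral_add h1 h2, ← integral_add h3 h4, ← integral_const_mul, ← e1]
  refine integral_congr_ae (Eventually.of_forall fun z => ?_)
  simp only [shiftError]
  ring

end ShiftError

/-! ### The inequality at a pair of maximizers. -/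

/-- The viscosity inequalities at a pair of maximizers of the doubled difference. -/
theorem sub_le_of_doubling_max [NeZero n] {φ : ℝ → ℝ} {a σ₁ σ₂ lam Lam : ℝ}
    (hφ : WeakScaling φ a σ₁ σ₂) (hlam : 0 < lam)
    {I : (Rn n → ℝ) → Rn n → ℝ} (hI : IsElliptic (classL0 n φ lam Lam) I)
    (hIt : IsTranslationInvariant I) {Ω : Set (Rn n)} {f u v : Rn n → ℝ}
    (hu : IsViscositySub I Ω f u) (hv : IsViscositySuper I Ω f v)
    (huv : ∀ x, x ∉ Ω → u x ≤ v x) {C : ℝ} (huC : ∀ x, |u x| ≤ C) (hvC : ∀ x, |v x| ≤ C)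
    {m c r ρ D : ℝ} {q x y : Rn n} (hm : 0 < m) (hc : 0 ≤ c) (hr : 0 < r) (hrρ : r ≤ ρ)
    (hρD : ρ ≤ D) (hei : Integrable (fun z => shiftError u v Ω C q x y z * tailKernel φ ρ z) volume)
    (hxρ : Metric.ball x ρ ⊆ Ω) (hyρ : Metric.ball y ρ ⊆ Ω) (hqD : Ω ⊆ Metric.ball q D)
    (hmxy : m ≤ u x - v y)
    (hmax : ∀ x' ∈ Ω, ∀ y' ∈ Ω, u x' - v y' - c * ‖x' - y'‖ ^ 2 ≤ u x - v y - c * ‖x - y‖ ^ 2) :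
    f x - f y ≤ normConst n φ * Lam * (4 * (c + 1) * (∫ z : Rn n, coreKernel φ r z)
      + 2 * ∫ z, shiftError u v Ω C q x y z * tailKernel φ ρ z)
      - 2 * m * (normConst n φ * lam) * ∫ z : Rn n, tailKernel φ D z := by
  have hρ := hr.trans_le hrρ
  have hC0 : 0 ≤ C := (abs_nonneg _).trans (huC 0)
  have hxΩ : x ∈ Ω := hxρ (Metric.mem_ball_self hρ)
  have hyΩ : y ∈ Ω := hyρ (Metric.mem_ball_self hρ)
  -- Each test function comes from maximality with the other variable frozen; the last coefficient
  -- `±1` makes the contact strict.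
  let ψ₁ := paraboloid (u x) c 1 x y
  let ψ₂ := paraboloid (v y) (-c) (-1) y x
  let w₁ := glue (Metric.ball x r) ψ₁ u
  let w₂ := glue (Metric.ball y r) ψ₂ v
  have hw₁ : IsBoundedFun w₁ :=
    isBoundedFun_glue_ball hu.bounded (contDiff_paraboloid _ _ _ _ _).continuous x r
  have hw₂ : IsBoundedFun w₂ :=
    isBoundedFun_glue_ball hv.bounded (contDiff_paraboloid _ _ _ _ _).continuous y r
  have hfx : f x ≤ I w₁ x := by
    refine hu.test x hxΩ _ ψ₁ Metric.isOpen_ball (Metric.mem_ball_self hr)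
      (contDiff_paraboloid _ _ _ _ _).contDiffOn (paraboloid_self _ _ _ _ _) ?_ hw₁
    intro z hz hzx
    have h1 := hmax z (hxρ (Metric.ball_subset_ball hrρ hz)) y hyΩ
    have h2 : 0 < ‖z - x‖ ^ 2 := by
      have := norm_pos_iff.2 (sub_ne_zero.2 hzx); positivity
    simp only [ψ₁, paraboloid]
    linarith
  have hfy : I w₂ y ≤ f y := by
    refine hv.test y hyΩ _ ψ₂ Metric.isOpen_ball (Metric.mem_ball_self hr)
      (contDiff_paraboloid _ _ _ _ _).contDiffOn (paraboloid_self _ _ _ _ _) ?_ hw₂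
    intro z hz hzy
    have h1 := hmax x hxΩ z (hyρ (Metric.ball_subset_ball hrρ hz))
    have h2 : 0 < ‖z - y‖ ^ 2 := by
      have := norm_pos_iff.2 (sub_ne_zero.2 hzy); positivity
    simp only [ψ₂, paraboloid]
    rw [norm_sub_rev z x, norm_sub_rev y x]
    linarith
  have hc₁ : C11At w₁ x := c11At_glue_paraboloid u _ _ _ _ _ hr
  have hc₂ : C11At w₂ y := c11At_glue_paraboloid v _ _ _ _ _ hr
  have ht₁ : I (fun z => w₁ (z + x)) 0 = I w₁ x := by
    have := hIt w₁ x 0 hw₁ (by rwa [zero_add])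
    rwa [zero_add] at this
  have ht₂ : I (fun z => w₂ (z + y)) 0 = I w₂ y := by
    have := hIt w₂ y 0 hw₂ (by rwa [zero_add])
    rwa [zero_add] at this
  -- Ellipticity compares two functions at one point, hence both are recentred at `0`.
  let F : Rn n → ℝ := (fun z => w₁ (z + x)) - fun z => w₂ (z + y)
  have hFb : IsBoundedFun F := by
    obtain ⟨hm₁, C₁, hC₁⟩ := isBoundedFun_translate hw₁ x
    obtain ⟨hm₂, C₂, hC₂⟩ := isBoundedFun_translate hw₂ y
    exact ⟨hm₁.sub hm₂, C₁ + C₂, fun z => (abs_sub _ _).trans (add_le_add (hC₁ z) (hC₂ z))⟩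
  have hFin : ∀ z, ‖z‖ < r → F z = ψ₁ (x + z) - ψ₂ (y + z) := by
    intro z hz
    have h1 : z + x ∈ Metric.ball x r := by simpa using hz
    have h2 : z + y ∈ Metric.ball y r := by simpa using hz
    simp only [F, Pi.sub_apply, w₁, w₂]
    rw [glue_of_mem h1, glue_of_mem h2, add_comm z x, add_comm z y]
  have hFout : ∀ z, r ≤ ‖z‖ → F z = u (x + z) - v (y + z) := by
    intro z hz
    have h1 : z + x ∉ Metric.ball x r := by simpa using hz
    have h2 : z + y ∉ Metric.ball y r := by simpa using hz
    simp only [F, Pi.sub_apply, w₁, w₂]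
    rw [glue_of_notMem h1, glue_of_notMem h2, add_comm z x, add_comm z y]
  have hF0 : F 0 = u x - v y := by
    rw [hFin 0 (by simpa using hr)]
    simp [ψ₁, ψ₂]
  -- A common shift preserves `x - y`, so the penalties cancel and need not tend to zero.
  have hboth : ∀ z, x + z ∈ Ω → y + z ∈ Ω → u (x + z) - v (y + z) ≤ u x - v y := by
    intro z hx hy
    have := hmax _ hx _ hy
    rw [add_sub_add_right_eq_sub] at this
    linarith
  have hnear : ∀ z, ‖z‖ < r → F z + F (-z) - 2 * F 0 = 4 * (c + 1) * ‖z‖ ^ 2 := by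
    intro z hz
    rw [hFin z hz, hFin (-z) (by rwa [norm_neg]), hF0]
    simp only [ψ₁, ψ₂, paraboloid_add, inner_neg_right, norm_neg]
    ring
  have hmid : ∀ z, r ≤ ‖z‖ → ‖z‖ < ρ → F z ≤ F 0 := by
    intro z hz hzρ
    rw [hFout z hz, hF0]
    exact hboth z (hxρ (by simpa using hzρ)) (hyρ (by simpa using hzρ))
  -- Here `u(q+z) ≤ v(q+z)` while `F 0 ≥ m`.
  have hnot : ∀ z, ρ ≤ ‖z‖ → q + z ∉ Ω → F z - F 0 ≤ shiftError u v Ω C q x y z - m := by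
    intro z hz hq
    rw [hFout z (hrρ.trans hz), hF0]
    have h1 := le_abs_self (u (x + z) - u (q + z))
    have h2 := neg_abs_le (v (y + z) - v (q + z))
    have h3 := huv _ hq
    have h4 : 0 ≤ 2 * C * (|Ω.indicator (fun _ => (1 : ℝ)) (x + z) -
        Ω.indicator (fun _ => (1 : ℝ)) (q + z)| + |Ω.indicator (fun _ => (1 : ℝ)) (y + z) -
        Ω.indicator (fun _ => (1 : ℝ)) (q + z)|) := by positivity
    simp only [shiftError]
    linarith
  have hfar : ∀ z, ρ ≤ ‖z‖ → F z - F 0 ≤ shiftError u v Ω C q x y z := by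
    intro z hz
    by_cases hq : q + z ∈ Ω
    · rw [hFout z (hrρ.trans hz), hF0]
      by_cases hxy : x + z ∈ Ω ∧ y + z ∈ Ω
      · have := hboth z hxy.1 hxy.2
        have := shiftError_nonneg u v Ω hC0 q x y z
        linarith
      -- One shifted point has left `Ω` although `q + z` has not: the indicator terms, weighted by
      -- `2C`, absorb the crude bound `u - v ≤ 2C`.
      · have hone : 1 ≤ |Ω.indicator (fun _ => (1 : ℝ)) (x + z) -
            Ω.indicator (fun _ => (1 : ℝ)) (q + z)| + |Ω.indicator (fun _ => (1 : ℝ)) (y + z) -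
            Ω.indicator (fun _ => (1 : ℝ)) (q + z)| := by
          rcases not_and_or.1 hxy with h | h
          · exact (one_le_abs_indicator_sub h hq).trans (le_add_of_nonneg_right (abs_nonneg _))
          · exact (one_le_abs_indicator_sub h hq).trans (le_add_of_nonneg_left (abs_nonneg _))
        have h0 := mul_le_mul_of_nonneg_left hone (by positivity : 0 ≤ 2 * C)
        have h1 := (abs_le.1 (huC (x + z))).2
        have h2 := (abs_le.1 (hvC (y + z))).1
        have h3 := abs_nonneg (u (x + z) - u (q + z))
        have h4 := abs_nonneg (v (y + z) - v (q + z))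
        simp only [shiftError]
        linarith
    · linarith [hnot z hz hq]
  have hout : ∀ z, D ≤ ‖z‖ → F z - F 0 ≤ shiftError u v Ω C q x y z - m := by
    intro z hz
    refine hnot z (hρD.trans hz) fun hq => ?_
    have := hqD hq
    simp only [Metric.mem_ball, dist_self_add_left] at this
    linarith
  have hell := hI.upper _ _ 0 (isBoundedFun_translate hw₁ x) (isBoundedFun_translate hw₂ y)
    (c11At_translate hc₁) (c11At_translate hc₂)
  rw [ht₁, ht₂] at hell
  have hsup : maxOp (classL0 n φ lam Lam) F 0 ≤ ((_ : ℝ) : EReal) :=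
    iSup₂_le fun K hK => EReal.coe_le_coe_iff.2 (linOp_le_of_secondDiff_le hφ hlam hK hFb
      (by positivity) hr hrρ hρD hm.le (shiftError_nonneg u v Ω hC0 q x y) hei hnear hmid hfar hout)
  have := EReal.coe_le_coe_iff.1 (hell.trans hsup)
  linarith

end IntegroDiff

end

/-! ### Passage to the limit and contradiction. -/

open IntegroDiff MeasureTheory Filter Topology

theorem mainTheorem8 (n : ℕ) [NeZero n] (φ : ℝ → ℝ) (a σ₁ σ₂ lam Lam : ℝ)
    (hφ : IntegroDiff.WeakScaling φ a σ₁ σ₂) (hlam : 0 < lam) (hLam : lam ≤ Lam)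
    (I : (IntegroDiff.Rn n → ℝ) → IntegroDiff.Rn n → ℝ)
    (hI : IntegroDiff.IsElliptic (IntegroDiff.classL0 n φ lam Lam) I)
    (hIt : IntegroDiff.IsTranslationInvariant I)
    (Ω : Set (IntegroDiff.Rn n)) (hΩ : IsOpen Ω) (hΩb : Bornology.IsBounded Ω)
    (f : IntegroDiff.Rn n → ℝ) (hf : ContinuousOn f Ω)
    (u v : IntegroDiff.Rn n → ℝ)
    (hu : IntegroDiff.IsViscositySub I Ω f u)
    (hv : IntegroDiff.IsViscositySuper I Ω f v)
    (huv : ∀ x, x ∉ Ω → u x ≤ v x) :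
    ∀ x ∈ Ω, u x ≤ v x := by
  intro p hp
  by_contra! hlt
  have hm : 0 < u p - v p := sub_pos.2 hlt
  obtain ⟨C₁, hC₁⟩ := hu.bounded.2
  obtain ⟨C₂, hC₂⟩ := hv.bounded.2
  have huC : ∀ x, |u x| ≤ max C₁ C₂ := fun x => (hC₁ x).trans (le_max_left _ _)
  have hvC : ∀ x, |v x| ≤ max C₁ C₂ := fun x => (hC₂ x).trans (le_max_right _ _)
  obtain ⟨c, x, y, q, hc, -, -, -, hx, hy, hmxy, hmq, hmax⟩ := exists_doubling_sequence
    hΩb.isCompact_closure hu.usc hv.lsc huC hvC (subset_closure hp)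
  -- The limit point keeps a positive difference, which is excluded off `Ω` and in particular on its
  -- boundary.
  have hq : q ∈ Ω := by
    by_contra hq
    linarith [huv q hq]
  obtain ⟨δ, hδ, hδΩ⟩ := Metric.isOpen_iff.1 hΩ q hq
  obtain ⟨D₀, hD₀⟩ := hΩb.subset_ball q
  have hρ : 0 < δ / 2 := half_pos hδ
  have hball : ∀ w : Rn n, dist w q < δ / 2 → Metric.ball w (δ / 2) ⊆ Ω := fun w hw =>
    (Metric.ball_subset_ball' (by linarith)).trans hδΩ
  have hqD : Ω ⊆ Metric.ball q (max D₀ (δ / 2)) :=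
    hD₀.trans (Metric.ball_subset_ball (le_max_left _ _))
  have htail := integrable_tailKernel (n := n) hφ hρ
  -- The order of limits matters: `c k` has no uniform bound, so the core is removed with `k` fixed,
  -- by letting `r = (δ/2)/(j+1)` tend to zero.
  have hev : ∀ᶠ k in atTop, f (x k) - f (y k) ≤ normConst n φ * Lam *
      (2 * ∫ z, shiftError u v Ω (max C₁ C₂) q (x k) (y k) z * tailKernel φ (δ / 2) z)
      - 2 * (u p - v p) * (normConst n φ * lam) *
        ∫ z : Rn n, tailKernel φ (max D₀ (δ / 2)) z := by
    filter_upwards [hx.eventually (Metric.ball_mem_nhds q hρ),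
      hy.eventually (Metric.ball_mem_nhds q hρ)] with k hxk hyk
    have hlim := ((((tendsto_integral_coreKernel (n := n) hφ hρ).const_mul
      (4 * (c k + 1))).add_const (2 * ∫ z, shiftError u v Ω (max C₁ C₂) q (x k) (y k) z *
        tailKernel φ (δ / 2) z)).const_mul (normConst n φ * Lam)).sub_const
        (2 * (u p - v p) * (normConst n φ * lam) * ∫ z : Rn n, tailKernel φ (max D₀ (δ / 2)) z)
    rw [mul_zero, zero_add] at hlim
    refine ge_of_tendsto' hlim fun j => ?_
    exact sub_le_of_doubling_max hφ hlam hI hIt hu hv huv huC hvC hm (hc k) (by positivity)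
      (div_le_self hρ.le (by linarith [(Nat.cast_nonneg j : (0 : ℝ) ≤ j)])) (le_max_right _ _)
      (integrable_shiftError_mul hu.bounded hv.bounded hΩ htail _ _ _ _) (hball _ hxk)
      (hball _ hyk) hqD (hmxy k)
      fun x' hx' y' hy' => hmax k x' (subset_closure hx') y' (subset_closure hy')
  have hfq := (hf.continuousAt (hΩ.mem_nhds hq)).tendsto
  have hL := (hfq.comp hx).sub (hfq.comp hy)
  have hR := (((tendsto_integral_shiftError_mul hu.bounded hv.bounded hΩ htail
    (tailKernel_nonneg hφ _) (max C₁ C₂) hx hy).const_mul 2).const_mul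
    (normConst n φ * Lam)).sub_const (2 * (u p - v p) * (normConst n φ * lam) *
      ∫ z : Rn n, tailKernel φ (max D₀ (δ / 2)) z)
  -- In the limit `k → ∞` only the strictly negative tail term remains on the right, against `f q -
  -- f q = 0` on the left.
  have hfin := le_of_tendsto_of_tendsto hL hR hev
  have hpos := integral_tailKernel_pos (n := n) hφ (hρ.trans_le (le_max_right D₀ (δ / 2)))
  have hN := normConst_pos (n := n) hφ
  have : 0 < 2 * (u p - v p) * (normConst n φ * lam) *
      ∫ z : Rn n, tailKernel φ (max D₀ (δ / 2)) z := by positivity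
  linarith
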